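/- For an integer $k\ge 1$ let $\mathfrak t(k,\mathbb R)$ be the space of real antisymmetric $k\times k$ matrices whose $(i,j)$-entry vanishes unless $|i-j|=1$. Let $1\le p<2$. For a continuous path $\gamma:[0,T]\to\mathbb R^d$ of bounded $p$-variation, the $n$-th level of the signature of $\gamma$ is $$\pi_n[S(\gamma)]=\int_{0<t_1<\cdots<t_n<T} d\gamma_{t_1}\otimes\cdots\otimes d\gamma_{t_n}\in(\mathbb R^d)^{\otimes n},$$ with $\pi_0[S(\gamma)]=1$. For a real-linear map $M$ from $\mathbb R^d$ into a real Lie algebra of $k\times k$ matrices, the development of $\gamma$ at $M$ is $$\mathscr D_\gamma(M)=I_k+\sum_{n=1}^\infty\int_{0<t_1<\cdots<t_n<T}M(d\gamma_{t_1})\cdots M(d\gamma_{t_n}),$$ where the products are matrix products. All iterated integrals are understood in Young's sense. **Corollary 5.1 (separation of points on the signature space).** Let $1\le p<2$, and let $\gamma_1:[0,T_1]\to\mathbb R^d$ and $\gamma_2:[0,T_2]\to\mathbb R^d$ be continuous paths of bounded $p$-variation. Suppose that their signatures differ at level $n$, that is, $\pi_n[S(\gamma_1)]\ne\pi_n[S(\gamma_2)]$.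 Let $k\ge n+1$, and let $\mathfrak h$ be any real Lie algebra of real or complex $k\times k$ matrices (with the commutator bracket) that contains $\mathfrak t(k,\mathbb R)$. Then there is a linear map $M:\mathbb R^d\to\mathfrak h$, with all its values in $\mathfrak t(k,\mathbb R)$, such that both developments $\mathscr D_{\gamma_1}(M)$ and $\mathscr D_{\gamma_2}(M)$ are well defined (the iterated integrals exist and the series converge absolutely) and $$\mathscr D_{\gamma_1}(M)\neq\mathscr D_{\gamma_2}(M).$$ -/

import Mathlib

open Set Filter Topology
open scoped TensorProduct

-- Matrices form a Lie algebra under the commutator bracket.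
attribute [local instance 100] LieRing.ofAssociativeRing

namespace PathDev

/-- `γ` has bounded `p`-variation on the interval `[a, b]`: the sums
`∑ ‖γ (tᵢ₊₁) - γ (tᵢ)‖ ^ p` over all finite subdivisions of `[a, b]` are bounded. -/
def BoundedPVariation {E : Type*} [NormedAddCommGroup E] (p : ℝ) (γ : ℝ → E) (a b : ℝ) : Prop :=
  ∃ C : ℝ, ∀ (N : ℕ) (t : ℕ → ℝ), Monotone t → (∀ i, t i ∈ Icc a b) →
    ∑ i ∈ Finset.range N, ‖γ (t (i + 1)) - γ (t i)‖ ^ p ≤ C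

section Young

variable {A : Type*} [Ring A] [TopologicalSpace A]

/-- `I` is the Young integral `∫ f dg` over `[a, b]`: the sums `∑ f (tᵢ) (g (tᵢ₊₁) - g (tᵢ))` over the
subdivisions `a = t₀ ≤ t₁ ≤ ⋯ ≤ t_N = b` converge to `I` as the mesh tends to `0`. The functions
take values in a topological ring; the integrand is multiplied on the left. -/
def HasYoungIntegral (f g : ℝ → A) (a b : ℝ) (I : A) : Prop :=
  ∀ U ∈ 𝓝 I, ∃ δ : ℝ, 0 < δ ∧ ∀ (N : ℕ) (t : ℕ → ℝ), Monotone t → t 0 = a → t N = b →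
    (∀ i < N, t (i + 1) - t i < δ) →
      ∑ i ∈ Finset.range N, f (t i) * (g (t (i + 1)) - g (t i)) ∈ U

/-- The Young integral `∫ f dg` over `[a, b]` exists. -/
def YoungIntegrable (f g : ℝ → A) (a b : ℝ) : Prop :=
  ∃ I : A, HasYoungIntegral f g a b I

open Classical in
/-- The Young integral `∫ f dg` over `[a, b]` (with the value `0` if it does not exist). -/
noncomputable def youngIntegral (f g : ℝ → A) (a b : ℝ) : A :=
  if h : YoungIntegrable f g a b then h.choose else 0

/-- The iterated integral `∫_{0 < t₁ < ⋯ < tₙ < t} dx₁(t₁) ⋯ dxₙ(tₙ)` as a function of `t`, in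
Young's sense: the `n`-th one is the Young integral of the `(n-1)`-st one against `dxₙ`. -/
noncomputable def iteratedIntegral : (n : ℕ) → (Fin n → ℝ → A) → ℝ → A
  | 0, _ => fun _ => 1
  | n + 1, x => fun t =>
      youngIntegral (iteratedIntegral n fun i => x i.castSucc) (x (Fin.last n)) 0 t

end Young

/-- The signature of a path `γ : [0, T] → ℝᵈ`. Its `n`-th level
`∫_{0 < t₁ < ⋯ < tₙ < T} dγ(t₁) ⊗ ⋯ ⊗ dγ(tₙ)` is the tensor whose coefficient at
`e_{w₁} ⊗ ⋯ ⊗ e_{wₙ}` is the iterated integral of the coordinates `w₁, …, wₙ` of `γ`. -/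
noncomputable def signature {d : ℕ} (T : ℝ) (γ : ℝ → EuclideanSpace ℝ (Fin d)) (n : ℕ) :
    ⨂[ℝ]^n (EuclideanSpace ℝ (Fin d)) :=
  ∑ W : Fin n → Fin d, iteratedIntegral n (fun i s => γ s (W i)) T •
    PiTensorProduct.tprod ℝ (fun i => EuclideanSpace.single (W i) (1 : ℝ))

/-- The real antisymmetric tridiagonal `k × k` matrices. -/
def tridiag (k : ℕ) : Submodule ℝ (Matrix (Fin k) (Fin k) ℝ) where
  carrier := {B | B + B.transpose = 0 ∧
    ∀ i j : Fin k, |((i : ℕ) : ℤ) - ((j : ℕ) : ℤ)| ≠ 1 → B i j = 0}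
  zero_mem' := by simp
  add_mem' := by
    rintro B C ⟨hB, hB'⟩ ⟨hC, hC'⟩
    refine ⟨?_, fun i j h => by simp [hB' i j h, hC' i j h]⟩
    rw [Matrix.transpose_add, add_add_add_comm, hB, hC, add_zero]
  smul_mem' := by
    rintro c B ⟨hB, hB'⟩
    refine ⟨?_, fun i j h => by simp [hB' i j h]⟩
    rw [Matrix.transpose_smul, ← smul_add, hB, smul_zero]

section Development

variable {d k : ℕ} {𝕜 : Type*} [RCLike 𝕜] {𝔥 : LieSubalgebra ℝ (Matrix (Fin k) (Fin k) 𝕜)}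

/-- The `n`-th term `∫_{0 < t₁ < ⋯ < tₙ < t} M(dγ(t₁)) ⋯ M(dγ(tₙ))` of the development, as a function
of `t`; the products are matrix products, and the term with `n = 0` is the identity matrix. -/
noncomputable def developmentTerm (γ : ℝ → EuclideanSpace ℝ (Fin d))
    (M : EuclideanSpace ℝ (Fin d) →ₗ[ℝ] 𝔥) (n : ℕ) : ℝ → Matrix (Fin k) (Fin k) 𝕜 :=
  iteratedIntegral n (fun _ s => (M (γ s) : Matrix (Fin k) (Fin k) 𝕜))

/-- The development of `γ : [0, T] → ℝᵈ` is well defined at `M`: all the iterated Young integrals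
exist, and their series converges (absolutely) in the space of matrices. -/
def DevelopmentConverges (T : ℝ) (γ : ℝ → EuclideanSpace ℝ (Fin d))
    (M : EuclideanSpace ℝ (Fin d) →ₗ[ℝ] 𝔥) : Prop :=
  (∀ n : ℕ, ∀ t ∈ Icc 0 T,
    YoungIntegrable (developmentTerm γ M n)
      (fun s => (M (γ s) : Matrix (Fin k) (Fin k) 𝕜)) 0 t) ∧
  Summable fun n => developmentTerm γ M n T

/-- The Cartan development at `M` of the path `γ : [0, T] → ℝᵈ`. -/
noncomputable def development (T : ℝ) (γ : ℝ → EuclideanSpace ℝ (Fin d))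
    (M : EuclideanSpace ℝ (Fin d) →ₗ[ℝ] 𝔥) : Matrix (Fin k) (Fin k) 𝕜 :=
  ∑' n, developmentTerm γ M n T

end Development

end PathDev

/-! If two signatures differ at level `n`, some word `W` of length `n` has different iterated
integrals along the two paths. Send `u` to the antisymmetric tridiagonal matrix whose superdiagonal
reads `lam * u (W i)`. A product of `m` tridiagonal matrices moves an index by at most `m`, so in
entry `(0, n)` of the development the terms with `m < n` vanish. For `m = n` the only route climbs
the superdiagonal, which gives `lam ^ n` times the iterated integral of `W`
(`iteratedIntegral_tridiag_apply`).

Antisymmetry makes the later terms nonzero, but the `m`-th one is at most `(L * lam) ^ m` with `L`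
independent of `lam`. The `(0, n)` entries of the two developments therefore differ by `lam ^ n * c
+ O(lam ^ (n + 1))` with `c ≠ 0`, which is nonzero for small `lam` (`tsum_ne_zero_of_leading_term`).
A geometric bound, without factorial decay, is enough because `lam` is free.

The analytic input is Young integration. Bounded `p`-variation with `p < 2` makes a path Hölder of
exponent `1 / p > 1 / 2` relative to a control, and integration preserves this regularity
(`ControlledBy.youngIntegrable`, `ControlledBy.integral`). Both rest on the discrete estimate
`norm_sum_sub_le_youngConst`. -/

namespace PathDev

/-! ### Subdivisions and Riemann sums. -/

section Subdivisions

/-- The filter on subdivisions of `[a, b]` generated by the sets of subdivisions of small mesh. A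
pair `(N, t)` stands for `a = t 0 ≤ t 1 ≤ ⋯ ≤ t N = b`. -/
def subdivisions (a b : ℝ) : Filter (ℕ × (ℕ → ℝ)) :=
  ⨅ δ ∈ Ioi (0 : ℝ), 𝓟 {P | Monotone P.2 ∧ P.2 0 = a ∧ P.2 P.1 = b ∧
    ∀ i < P.1, P.2 (i + 1) - P.2 i < δ}

/-- The left-point Riemann sum of `f` against `g` along a subdivision. -/
def riemannSum {A : Type*} [Ring A] (f g : ℝ → A) (P : ℕ × (ℕ → ℝ)) : A :=
  ∑ i ∈ Finset.range P.1, f (P.2 i) * (g (P.2 (i + 1)) - g (P.2 i))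

lemma hasBasis_subdivisions (a b : ℝ) :
    (subdivisions a b).HasBasis (fun δ : ℝ => 0 < δ) fun δ => {P | Monotone P.2 ∧ P.2 0 = a ∧
      P.2 P.1 = b ∧ ∀ i < P.1, P.2 (i + 1) - P.2 i < δ} := by
  refine hasBasis_biInf_principal' (p := fun δ : ℝ => 0 < δ) ?_ ⟨1, one_pos⟩
  intro δ hδ ε hε
  refine ⟨min δ ε, lt_min hδ hε, ?_, ?_⟩ <;> rintro P ⟨h1, h2, h3, h4⟩ <;>
    refine ⟨h1, h2, h3, fun i hi => (h4 i hi).trans_le ?_⟩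
  exacts [min_le_left _ _, min_le_right _ _]

/-- Read as a limit along a filter, the integral inherits uniqueness and compatibility with sums,
scalars and continuous maps from `Tendsto`. -/
lemma hasYoungIntegral_iff {A : Type*} [Ring A] [TopologicalSpace A] {f g : ℝ → A} {a b : ℝ}
    {I : A} : HasYoungIntegral f g a b I ↔ Tendsto (riemannSum f g) (subdivisions a b) (𝓝 I) := by
  rw [(hasBasis_subdivisions a b).tendsto_left_iff]
  constructor
  · intro h U hU
    obtain ⟨δ, hδ, H⟩ := h U hU
    exact ⟨δ, hδ, fun P hP => H P.1 P.2 hP.1 hP.2.1 hP.2.2.1 hP.2.2.2⟩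
  · intro h U hU
    obtain ⟨δ, hδ, H⟩ := h U hU
    exact ⟨δ, hδ, fun N t h1 h2 h3 h4 => @H (N, t) ⟨h1, h2, h3, h4⟩⟩

/-- The subdivision of `[0, t]` that cuts both `[0, s]` and `[s, t]` into `N` equal parts. -/
noncomputable def twoPartSubdivision (s t : ℝ) (N : ℕ) : ℕ × (ℕ → ℝ) :=
  (N + N, fun i => (min i N : ℕ) * (s / N) + (i - N : ℕ) * ((t - s) / N))

/-- The subdivision of `[0, s]` into `N` equal parts. -/
noncomputable def uniformSubdivision (s : ℝ) (N : ℕ) : ℕ × (ℕ → ℝ) :=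
  (N, fun i => i * (s / N))

lemma tendsto_uniformSubdivision {s : ℝ} (hs : 0 ≤ s) :
    Tendsto (uniformSubdivision s) atTop (subdivisions 0 s) := by
  rw [(hasBasis_subdivisions 0 s).tendsto_right_iff]
  intro δ hδ
  have h1 : ∀ᶠ N : ℕ in atTop, s / N < δ :=
    (tendsto_const_div_atTop_nhds_zero_nat s).eventually (gt_mem_nhds hδ)
  filter_upwards [h1, eventually_gt_atTop 0] with N hN hN0
  have hN0' : (0 : ℝ) < N := by exact_mod_cast hN0
  refine ⟨fun i j hij => ?_, by simp [uniformSubdivision], ?_, fun i _ => ?_⟩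
  · simp only [uniformSubdivision]; gcongr
  · simp only [uniformSubdivision]; field_simp
  · simp only [uniformSubdivision]; push_cast; linarith

/-- Its first `N` steps are those of `uniformSubdivision s N`, so subtracting the two Riemann sums
leaves a sum over `[s, t]` alone. -/
lemma tendsto_twoPartSubdivision {s t : ℝ} (hs : 0 ≤ s) (hst : s ≤ t) :
    Tendsto (twoPartSubdivision s t) atTop (subdivisions 0 t) := by
  rw [(hasBasis_subdivisions 0 t).tendsto_right_iff]
  intro δ hδ
  have h1 : ∀ᶠ N : ℕ in atTop, s / N < δ :=
    (tendsto_const_div_atTop_nhds_zero_nat s).eventually (gt_mem_nhds hδ)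
  have h2 : ∀ᶠ N : ℕ in atTop, (t - s) / N < δ :=
    (tendsto_const_div_atTop_nhds_zero_nat (t - s)).eventually (gt_mem_nhds hδ)
  filter_upwards [h1, h2, eventually_gt_atTop 0] with N hN hN' hN0
  have hN0' : (0 : ℝ) < N := by exact_mod_cast hN0
  have hts := sub_nonneg.2 hst
  refine ⟨fun i j hij => ?_, by simp [twoPartSubdivision], ?_, fun i _ => ?_⟩
  · simp only [twoPartSubdivision]; gcongr
  · simp only [twoPartSubdivision]
    rw [min_eq_right (by omega), Nat.add_sub_cancel]
    field_simp; ring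
  · simp only [twoPartSubdivision]
    rcases lt_or_ge i N with h | h
    · rw [min_eq_left (by omega), min_eq_left (by omega), Nat.sub_eq_zero_of_le (by omega),
        Nat.sub_eq_zero_of_le (by omega)]
      push_cast; linarith
    · rw [min_eq_right (by omega), min_eq_right (by omega), Nat.sub_add_comm h]
      push_cast; linarith

lemma subdivisions_neBot {b : ℝ} (hb : 0 ≤ b) : (subdivisions 0 b).NeBot :=
  (tendsto_uniformSubdivision hb).neBot

lemma eventually_mem_subdivisions (a b : ℝ) :
    ∀ᶠ P in subdivisions a b, Monotone P.2 ∧ P.2 0 = a ∧ P.2 P.1 = b ∧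
      ∀ i ≤ P.1, P.2 i ∈ Icc a b := by
  filter_upwards [(hasBasis_subdivisions a b).mem_of_mem one_pos] with P hP
  refine ⟨hP.1, hP.2.1, hP.2.2.1, fun i hi => ⟨?_, ?_⟩⟩
  · rw [← hP.2.1]; exact hP.1 (Nat.zero_le _)
  · rw [← hP.2.2.1]; exact hP.1 hi

end Subdivisions

/-! ### Uniqueness of the Young integral. -/

section Basic

variable {A : Type*} [Ring A] [TopologicalSpace A] {f g f' g' : ℝ → A} {a b : ℝ} {I J : A}

lemma HasYoungIntegral.unique [T2Space A] (hb : 0 ≤ b) (hI : HasYoungIntegral f g 0 b I)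
    (hJ : HasYoungIntegral f g 0 b J) : I = J := by
  have := subdivisions_neBot hb
  exact tendsto_nhds_unique (hasYoungIntegral_iff.1 hI) (hasYoungIntegral_iff.1 hJ)

lemma YoungIntegrable.hasYoungIntegral (h : YoungIntegrable f g a b) :
    HasYoungIntegral f g a b (youngIntegral f g a b) := by
  rw [youngIntegral, dif_pos h]; exact h.choose_spec

lemma HasYoungIntegral.youngIntegral_eq [T2Space A] (hb : 0 ≤ b)
    (hI : HasYoungIntegral f g 0 b I) : youngIntegral f g 0 b = I :=
  (YoungIntegrable.hasYoungIntegral ⟨I, hI⟩).unique hb hI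

lemma youngIntegral_self [T2Space A] : youngIntegral f g 0 0 = 0 := by
  refine HasYoungIntegral.youngIntegral_eq le_rfl (hasYoungIntegral_iff.2 ?_)
  refine tendsto_const_nhds.congr' ?_
  filter_upwards [eventually_mem_subdivisions 0 0] with P hP
  refine (Finset.sum_eq_zero fun i hi => ?_).symm
  have hi := Finset.mem_range.1 hi
  have h1 := hP.2.2.2 i hi.le
  have h2 := hP.2.2.2 (i + 1) hi
  rw [Icc_self, mem_singleton_iff] at h1 h2
  rw [h1, h2, sub_self, mul_zero]

end Basic

/-! ### Matrix integrals, entry by entry. -/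

section Matrix

variable {ι A : Type*} [Fintype ι] [DecidableEq ι] [Ring A]

lemma riemannSum_matrix_apply (F G : ℝ → Matrix ι ι A) (P : ℕ × (ℕ → ℝ)) (i l : ι) :
    riemannSum F G P i l = ∑ j, riemannSum (fun s => F s i j) (fun s => G s j l) P := by
  simp only [riemannSum, Matrix.sum_apply, Matrix.mul_apply, Matrix.sub_apply]
  rw [Finset.sum_comm]

/-- The topology on matrices is the product one, so scalar integrals of entries suffice and no
matrix norm is needed. -/
lemma hasYoungIntegral_matrix [TopologicalSpace A] [IsTopologicalRing A] {F G : ℝ → Matrix ι ι A} {a b : ℝ} {J : ι → ι → ι → A}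
    (h : ∀ i j l, HasYoungIntegral (fun s => F s i j) (fun s => G s j l) a b (J i j l)) :
    HasYoungIntegral F G a b (Matrix.of fun i l => ∑ j, J i j l) := by
  rw [hasYoungIntegral_iff]
  refine tendsto_pi_nhds.2 fun i => tendsto_pi_nhds.2 fun l => ?_
  have := tendsto_finsetSum (Finset.univ : Finset ι) fun j _ =>
    hasYoungIntegral_iff.1 (h i j l)
  refine this.congr fun P => (riemannSum_matrix_apply F G P i l).symm

end Matrix

end PathDev

namespace PathDev

/-! ### The discrete Young estimate. -/

section Discrete

/-- The constant in the Young estimate with exponent `θ > 1`. -/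
noncomputable def youngConst (θ : ℝ) : ℝ := 2 / (1 - 2 * (1 / 2) ^ θ)

lemma two_mul_half_rpow_lt_one {θ : ℝ} (hθ : 1 < θ) : 2 * (1 / 2 : ℝ) ^ θ < 1 := by
  have := Real.rpow_lt_rpow_of_exponent_gt (x := 1 / 2) (by norm_num) (by norm_num) hθ
  rw [Real.rpow_one] at this
  linarith

lemma youngConst_pos {θ : ℝ} (hθ : 1 < θ) : 0 < youngConst θ :=
  div_pos two_pos (by linarith [two_mul_half_rpow_lt_one hθ])

/-- The constant is the fixed point of the bisection recursion: each half contributes `C * (1 / 2) ^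
θ`, and the two cross terms contribute `1` each. -/
lemma youngConst_eq {θ : ℝ} (hθ : 1 < θ) :
    youngConst θ * (2 * (1 / 2) ^ θ) + 2 = youngConst θ := by
  have := two_mul_half_rpow_lt_one hθ
  have h : (1 - 2 * (1 / 2 : ℝ) ^ θ) ≠ 0 := by linarith
  rw [youngConst]; field_simp; ring

/-- A monotone sequence can be bisected at some step. -/
lemma exists_bisection {w : ℕ → ℝ} {a b : ℕ} (hab : a < b)
    (hw : ∀ i j, i ≤ j → j ≤ b → w i ≤ w j) :
    ∃ k, a ≤ k ∧ k < b ∧ w k - w a ≤ (w b - w a) / 2 ∧ w b - w (k + 1) ≤ (w b - w a) / 2 := by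
  classical
  have h0 : 0 ≤ (w b - w a) / 2 := by linarith [hw a b hab.le le_rfl]
  -- Take the least such `k`: its minimality bounds the left part.
  have hex : ∃ k, a ≤ k ∧ w b - w (k + 1) ≤ (w b - w a) / 2 :=
    ⟨b - 1, by omega, by rw [Nat.sub_add_cancel (by omega), sub_self]; exact h0⟩
  have hle : Nat.find hex ≤ b - 1 :=
    Nat.find_min' hex ⟨by omega, by rw [Nat.sub_add_cancel (by omega), sub_self]; exact h0⟩
  obtain ⟨h1, h2⟩ := Nat.find_spec hex
  refine ⟨Nat.find hex, h1, by omega, ?_, h2⟩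
  rcases h1.eq_or_lt with h | h
  · rw [← h, sub_self]; exact h0
  · have := Nat.find_min hex (m := Nat.find hex - 1) (by omega)
    rw [not_and, not_le, Nat.sub_add_cancel (by omega)] at this
    linarith [this (by omega)]

variable {A : Type*} [NormedRing A]

/-- The discrete Young estimate. -/
lemma norm_sum_sub_le_youngConst {f g : ℕ → A} {w : ℕ → ℝ} {η θ : ℝ} {N : ℕ} (hθ : 1 < θ)
    (hη : 0 ≤ η) (hw : ∀ i j, i ≤ j → j ≤ N → w i ≤ w j)
    (H : ∀ i j l, i ≤ j → j ≤ l → l ≤ N → ‖(f j - f i) * (g l - g j)‖ ≤ η * (w l - w i) ^ θ)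
    {a b : ℕ} (hab : a ≤ b) (hb : b ≤ N) :
    ‖∑ i ∈ Finset.Ico a b, f i * (g (i + 1) - g i) - f a * (g b - g a)‖ ≤
      youngConst θ * η * (w b - w a) ^ θ := by
  induction hn : b - a using Nat.strong_induction_on generalizing a b with
  | _ n ih =>
  have hC := youngConst_pos hθ
  have h0 : 0 ≤ w b - w a := sub_nonneg.2 (hw a b hab hb)
  rcases hab.eq_or_lt with rfl | hlt
  · simp only [Finset.Ico_self, Finset.sum_empty, sub_self, mul_zero, norm_zero]
    positivity
  obtain ⟨k, hak, hkb, h1, h2⟩ := exists_bisection hlt fun i j hij hj => hw i j hij (hj.trans hb)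
  have e1 := ih (k - a) (by omega) hak (by omega) rfl
  have e2 := ih (b - (k + 1)) (by omega) hkb hb rfl
  have e3 := H a k (k + 1) hak (by omega) (by omega)
  have e4 := H a (k + 1) b (by omega) hkb hb
  have hhalf : ((w b - w a) / 2) ^ θ = (1 / 2) ^ θ * (w b - w a) ^ θ := by
    rw [← Real.mul_rpow (by norm_num) h0]; congr 1; ring
  have hθ0 : 0 ≤ θ := by linarith
  have m1 : (w k - w a) ^ θ ≤ (1 / 2) ^ θ * (w b - w a) ^ θ := by
    rw [← hhalf]
    exact Real.rpow_le_rpow (sub_nonneg.2 (hw a k hak (by omega))) h1 hθ0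
  have m2 : (w b - w (k + 1)) ^ θ ≤ (1 / 2) ^ θ * (w b - w a) ^ θ := by
    rw [← hhalf]
    exact Real.rpow_le_rpow (sub_nonneg.2 (hw _ b hkb hb)) h2 hθ0
  have m3 : (w (k + 1) - w a) ^ θ ≤ (w b - w a) ^ θ :=
    Real.rpow_le_rpow (sub_nonneg.2 (hw _ _ (by omega) (by omega)))
      (by linarith [hw (k + 1) b hkb hb]) hθ0
  -- No point need halve the control exactly, so one step `[k, k + 1]` is isolated between two
  -- blocks of at most half the size. Restarting `f` at `k` and at `k + 1` costs the two products
  -- bounded by `H`.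
  have key : ∑ i ∈ Finset.Ico a b, f i * (g (i + 1) - g i) - f a * (g b - g a) =
      (∑ i ∈ Finset.Ico a k, f i * (g (i + 1) - g i) - f a * (g k - g a)) +
      (∑ i ∈ Finset.Ico (k + 1) b, f i * (g (i + 1) - g i) - f (k + 1) * (g b - g (k + 1))) +
      (f k - f a) * (g (k + 1) - g k) + (f (k + 1) - f a) * (g b - g (k + 1)) := by
    rw [← Finset.sum_Ico_consecutive _ hak hkb.le, Finset.sum_eq_sum_Ico_succ_bot hkb]
    noncomm_ring
  rw [key]
  set W := (w b - w a) ^ θ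
  calc _ ≤ _ := norm_add₄_le
    _ ≤ youngConst θ * η * ((1 / 2) ^ θ * W) + youngConst θ * η * ((1 / 2) ^ θ * W) + η * W + η * W := by
      gcongr
      · exact e1.trans (by gcongr)
      · exact e2.trans (by gcongr)
      · exact e3.trans (by gcongr)
    _ = (youngConst θ * (2 * (1 / 2) ^ θ) + 2) * η * W := by ring
    _ = _ := by rw [youngConst_eq hθ]

end Discrete

/-! ### Controls and Young's theorem. -/

section Control

/-- `v` is increasing on `[0, T]`, with total increment at most `1`. -/
structure IsControl (T : ℝ) (v : ℝ → ℝ) : Prop where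
  mono : MonotoneOn v (Icc 0 T)
  sub_le_one : ∀ s ∈ Icc 0 T, ∀ t ∈ Icc 0 T, v t - v s ≤ 1

/-- `f` is Hölder continuous with exponent `α` and constant `K` relative to the control `v`. -/
def ControlledBy {E : Type*} [NormedAddCommGroup E] (T : ℝ) (v : ℝ → ℝ) (α K : ℝ) (f : ℝ → E) :
    Prop :=
  ∀ s t, 0 ≤ s → s ≤ t → t ≤ T → ‖f t - f s‖ ≤ K * (v t - v s) ^ α

variable {T α K κ : ℝ} {v : ℝ → ℝ}

lemma IsControl.sub_nonneg (hv : IsControl T v) {s t : ℝ} (hs : 0 ≤ s) (hst : s ≤ t) (ht : t ≤ T) :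
    0 ≤ v t - v s :=
  _root_.sub_nonneg.2 (hv.mono ⟨hs, hst.trans ht⟩ ⟨hs.trans hst, ht⟩ hst)

lemma IsControl.rpow_le_one (hv : IsControl T v) {s t β : ℝ} (hβ : 0 ≤ β) (hs : 0 ≤ s)
    (hst : s ≤ t) (ht : t ≤ T) : (v t - v s) ^ β ≤ 1 :=
  Real.rpow_le_one (hv.sub_nonneg hs hst ht)
    (hv.sub_le_one s ⟨hs, hst.trans ht⟩ t ⟨hs.trans hst, ht⟩) hβ

variable {A : Type*} [NormedRing A] {f g : ℝ → A}

/-- By uniform continuity, a path loses arbitrarily little of its size over short intervals when the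
exponent is lowered. -/
lemma ControlledBy.exists_small_half (hv : IsControl T v) (hα : 1 / 2 < α) (hκ : 0 ≤ κ)
    (hg : ControlledBy T v α κ g) (hgc : ContinuousOn g (Icc 0 T)) {η : ℝ} (hη : 0 < η) :
    ∃ δ > 0, ∀ s t, 0 ≤ s → s ≤ t → t ≤ T → t - s < δ →
      ‖g t - g s‖ ≤ η * (v t - v s) ^ (1 / 2 : ℝ) := by
  have hα0 : 0 < α := by linarith
  -- Chosen so that `α * (1 - β) = 1 / 2`. The power `β` of the increment is small by uniform
  -- continuity of `g`, and the power `1 - β` is bounded through the control. The control itself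
  -- need not be continuous.
  set β : ℝ := 1 - 1 / (2 * α)
  have hβ' : 1 / (2 * α) < 1 := by rw [div_lt_one (by linarith)]; linarith
  have hβ : 0 < β := by simp only [β]; linarith
  have hβ1 : 0 ≤ 1 - β := by simp only [β]; ring_nf; positivity
  have hlim : Tendsto (fun ε : ℝ => ε ^ β * κ ^ (1 - β)) (𝓝[>] 0) (𝓝 0) := by
    have : ContinuousAt (fun ε : ℝ => ε ^ β * κ ^ (1 - β)) 0 :=
      (Real.continuousAt_rpow_const 0 β (Or.inr hβ.le)).mul continuousAt_const
    have h := this.tendsto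
    simp only [Real.zero_rpow hβ.ne', zero_mul] at h
    exact h.mono_left nhdsWithin_le_nhds
  obtain ⟨ε, hε, hε0⟩ := ((hlim.eventually (gt_mem_nhds hη)).and self_mem_nhdsWithin).exists
  have hε0 : 0 < ε := hε0
  obtain ⟨δ, hδ, H⟩ := Metric.uniformContinuousOn_iff.1
    (isCompact_Icc.uniformContinuousOn_of_continuous hgc) ε hε0
  refine ⟨δ, hδ, fun s t hs hst ht hlt => ?_⟩
  have hω := hv.sub_nonneg hs hst ht
  have h1 : ‖g t - g s‖ ≤ ε := by
    rw [← dist_eq_norm]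
    refine (H t ⟨hs.trans hst, ht⟩ s ⟨hs, hst.trans ht⟩ ?_).le
    rw [Real.dist_eq, abs_of_nonneg (by linarith)]; exact hlt
  have h2 := hg s t hs hst ht
  calc ‖g t - g s‖ = ‖g t - g s‖ ^ β * ‖g t - g s‖ ^ (1 - β) := by
        rw [← Real.rpow_add_of_nonneg (norm_nonneg _) hβ.le hβ1, add_sub_cancel, Real.rpow_one]
    _ ≤ ε ^ β * (κ * (v t - v s) ^ α) ^ (1 - β) := by gcongr
    _ = ε ^ β * κ ^ (1 - β) * (v t - v s) ^ (1 / 2 : ℝ) := by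
        rw [Real.mul_rpow hκ (Real.rpow_nonneg hω _), ← Real.rpow_mul hω, mul_assoc]
        congr 3
        simp only [β]; field_simp; ring
    _ ≤ _ := by gcongr

/-- The Young estimate for Riemann sums. -/
lemma norm_riemannSum_sub_le (hv : IsControl T v) {η θ : ℝ} (hθ : 1 < θ) (hη : 0 ≤ η) {N : ℕ}
    {t : ℕ → ℝ} (ht : ∀ i j, i ≤ j → j ≤ N → t i ≤ t j) (h0 : 0 ≤ t 0) (hT : t N ≤ T)
    (H : ∀ a b c, t 0 ≤ a → a ≤ b → b ≤ c → c ≤ t N →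
      ‖(f b - f a) * (g c - g b)‖ ≤ η * (v c - v a) ^ θ) :
    ‖∑ i ∈ Finset.range N, f (t i) * (g (t (i + 1)) - g (t i)) - f (t 0) * (g (t N) - g (t 0))‖ ≤
      youngConst θ * η * (v (t N) - v (t 0)) ^ θ := by
  rw [Finset.range_eq_Ico]
  refine norm_sum_sub_le_youngConst (f := f ∘ t) (g := g ∘ t) (w := v ∘ t) hθ hη
    (fun i j hij hj => hv.mono ⟨?_, ?_⟩ ⟨?_, ?_⟩ (ht i j hij hj))
    (fun i j l hij hjl hl => H _ _ _ ?_ ?_ ?_ ?_) (Nat.zero_le N) le_rfl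
  · exact h0.trans (ht 0 i (Nat.zero_le _) (hij.trans hj))
  · exact (ht i N (hij.trans hj) le_rfl).trans hT
  · exact h0.trans (ht 0 j (Nat.zero_le _) hj)
  · exact (ht j N hj le_rfl).trans hT
  · exact ht 0 i (Nat.zero_le _) (by omega)
  · exact ht i j hij (by omega)
  · exact ht j l hjl hl
  · exact ht l N hl le_rfl

/-- The contribution of `[a, b] ∩ [c, d]` to a Riemann sum. -/
noncomputable def cellTerm (f g : ℝ → A) (a b c d : ℝ) : A :=
  if max a c < min b d then f (max a c) * (g (min b d) - g (max a c)) else 0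

lemma cellTerm_symm (f g : ℝ → A) (a b c d : ℝ) : cellTerm f g a b c d = cellTerm f g c d a b := by
  rw [cellTerm, cellTerm, max_comm, min_comm]

/-- A cell `[c, d]` clamped to `[a, b]` collapses to a point when they do not overlap. The right
side is symmetric in the two cells, so two subdivisions can be compared with one common sum. -/
lemma clamp_term_eq_cellTerm (f g : ℝ → A) {a b c d : ℝ} (hab : a ≤ b) (hcd : c ≤ d) :
    f (max a (min c b)) * (g (max a (min d b)) - g (max a (min c b))) = cellTerm f g a b c d := by
  rw [cellTerm]
  split_ifs with h
  · rw [max_lt_iff, lt_min_iff, lt_min_iff] at h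
    rw [min_eq_left h.2.1.le, min_comm d b, max_eq_right (le_min hab h.1.2.le)]
  · have : max a (min c b) = max a (min d b) := by
      rw [not_lt, min_le_iff, le_max_iff, le_max_iff] at h
      rcases h with (h | h) | h | h
      · rw [max_eq_left ((min_le_right _ _).trans h), max_eq_left ((min_le_right _ _).trans h)]
      · rw [min_eq_right h, min_eq_right (h.trans hcd)]
      · rw [max_eq_left ((min_le_left _ _).trans h),
          max_eq_left ((min_le_left _ _).trans (hcd.trans h))]
      · rw [le_antisymm hcd h]
    rw [this, sub_self, mul_zero]

/-- A Riemann sum over a fine subdivision is close to that over its common refinement with any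
other subdivision. -/
lemma norm_riemannSum_sub_sum_cellTerm_le (hv : IsControl T v) {η θ : ℝ} (hθ : 1 < θ) (hη : 0 ≤ η)
    {b : ℝ} (hb : b ≤ T) {N M : ℕ} {s t : ℕ → ℝ} (ht : Monotone t) (ht0 : t 0 = 0) (htN : t N = b)
    (hs : Monotone s) (hs0 : s 0 = 0) (hsM : s M = b) {δ : ℝ} (hδ : ∀ i < N, t (i + 1) - t i < δ)
    (H : ∀ x y z, 0 ≤ x → x ≤ y → y ≤ z → z ≤ T → z - x < δ →
      ‖(f y - f x) * (g z - g y)‖ ≤ η * (v z - v x) ^ θ) :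
    ‖riemannSum f g (N, t) - ∑ i ∈ Finset.range N, ∑ j ∈ Finset.range M,
      cellTerm f g (t i) (t (i + 1)) (s j) (s (j + 1))‖ ≤ youngConst θ * η := by
  have hC := youngConst_pos hθ
  have hpos : ∀ i, 0 ≤ t i := fun i => ht0 ▸ ht (Nat.zero_le i)
  have hle : ∀ i ≤ N, t i ≤ b := fun i hi => htN ▸ ht hi
  have hb0 : 0 ≤ b := htN ▸ hpos N
  rw [riemannSum, ← Finset.sum_sub_distrib]
  calc _ ≤ ∑ i ∈ Finset.range N, youngConst θ * η * (v (t (i + 1)) - v (t i)) := by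
        refine norm_sum_le_of_le _ fun i hi => ?_
        have hi := Finset.mem_range.1 hi
        have hii : t i ≤ t (i + 1) := ht (Nat.le_succ i)
        set r : ℕ → ℝ := fun j => max (t i) (min (s j) (t (i + 1)))
        have hr : Monotone r := fun j l hjl => max_le_max le_rfl (min_le_min (hs hjl) le_rfl)
        have hr0 : r 0 = t i := by
          simp only [r, hs0]
          rw [min_eq_left (hpos _), max_eq_left (hpos _)]
        have hrM : r M = t (i + 1) := by
          simp only [r, hsM]
          rw [min_eq_right (hle _ hi), max_eq_right hii]
        have h1 := norm_riemannSum_sub_le (f := f) (g := g) hv hθ hη (N := M) (t := r)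
          (fun j l hjl _ => hr hjl) (by rw [hr0]; exact hpos i)
          (by rw [hrM]; exact (hle _ hi).trans hb) (by
            rw [hr0, hrM]
            intro x y z hx hxy hyz hz
            exact H x y z ((hpos i).trans hx) hxy hyz (hz.trans ((hle _ hi).trans hb))
              (by linarith [hδ i hi]))
        rw [hr0, hrM] at h1
        simp only [r, clamp_term_eq_cellTerm f g hii (hs (Nat.le_succ _))] at h1
        rw [norm_sub_rev]
        refine h1.trans ?_
        have hω := hv.sub_nonneg (hpos i) hii ((hle _ hi).trans hb)
        have hω1 := hv.sub_le_one (t i) ⟨hpos i, hii.trans ((hle _ hi).trans hb)⟩ (t (i + 1))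
          ⟨hpos _, (hle _ hi).trans hb⟩
        gcongr
        -- Since `θ > 1` and the increment is at most `1`, its power is at most the increment
        -- itself, and the sum telescopes.
        simpa using Real.rpow_le_rpow_of_exponent_ge' hω hω1 zero_le_one hθ.le
    _ = youngConst θ * η * (v b - v 0) := by
        rw [← Finset.mul_sum, Finset.sum_range_sub (fun i => v (t i)), htN, ht0]
    _ ≤ youngConst θ * η * 1 := by
        gcongr
        exact hv.sub_le_one 0 ⟨le_rfl, hb0.trans hb⟩ b ⟨hb0, hb⟩
    _ = _ := mul_one _

/-- **Young's theorem**: existence of the integral. -/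
theorem ControlledBy.youngIntegrable [CompleteSpace A] (hv : IsControl T v) (hα : 1 / 2 < α)
    (hK : 0 ≤ K) (hκ : 0 ≤ κ) (hf : ControlledBy T v α K f) (hg : ControlledBy T v α κ g)
    (hgc : ContinuousOn g (Icc 0 T)) {b : ℝ} (hb0 : 0 ≤ b) (hb : b ≤ T) :
    YoungIntegrable f g 0 b := by
  have hne := subdivisions_neBot hb0
  have hθ : 1 < α + 1 / 2 := by linarith
  have hC := youngConst_pos hθ
  suffices h : Cauchy (map (riemannSum f g) (subdivisions 0 b)) by
    obtain ⟨I, hI⟩ := CompleteSpace.complete h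
    exact ⟨I, hasYoungIntegral_iff.2 hI⟩
  refine Metric.cauchy_iff.2 ⟨inferInstance, fun ε hε => ?_⟩
  -- Each of the two Riemann sums then lies within `ε / 4` of the sum over the common refinement; `K
  -- + 1` avoids dividing by zero.
  set η : ℝ := ε / (4 * youngConst (α + 1 / 2) * (K + 1))
  have hη : 0 < η := by positivity
  obtain ⟨δ, hδ, H⟩ := hg.exists_small_half hv hα hκ hgc hη
  have H' : ∀ x y z, 0 ≤ x → x ≤ y → y ≤ z → z ≤ T → z - x < δ →
      ‖(f y - f x) * (g z - g y)‖ ≤ K * η * (v z - v x) ^ (α + 1 / 2) := by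
    intro x y z hx hxy hyz hz hxz
    have w1 := hv.sub_nonneg hx hxy (hyz.trans hz)
    have w2 := hv.sub_nonneg (hx.trans hxy) hyz hz
    calc _ ≤ _ := norm_mul_le _ _
      _ ≤ (K * (v y - v x) ^ α) * (η * (v z - v y) ^ (1 / 2 : ℝ)) := by
        gcongr
        · exact hf x y hx hxy (hyz.trans hz)
        · exact H y z (hx.trans hxy) hyz hz (by linarith)
      _ ≤ (K * (v z - v x) ^ α) * (η * (v z - v x) ^ (1 / 2 : ℝ)) := by
        have w3 : 0 ≤ (v z - v x) ^ α := Real.rpow_nonneg (by linarith) _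
        gcongr <;> linarith
      _ = _ := by rw [Real.rpow_add_of_nonneg (by linarith) (by linarith) (by norm_num)]; ring
  refine ⟨_, image_mem_map ((hasBasis_subdivisions 0 b).mem_of_mem hδ), ?_⟩
  rintro _ ⟨⟨N, t⟩, ⟨ht, ht0, htN, htd⟩, rfl⟩ _ ⟨⟨M, s⟩, ⟨hs, hs0, hsM, hsd⟩, rfl⟩
  have e1 := norm_riemannSum_sub_sum_cellTerm_le hv hθ (by positivity) hb ht ht0 htN hs hs0 hsM
    htd H'
  have e2 := norm_riemannSum_sub_sum_cellTerm_le hv hθ (by positivity) hb hs hs0 hsM ht ht0 htN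
    hsd H'
  rw [Finset.sum_comm] at e2
  simp only [cellTerm_symm f g (s _)] at e2
  have e3 : youngConst (α + 1 / 2) * (K * η) ≤ ε / 4 := by
    have : youngConst (α + 1 / 2) * ((K + 1) * η) = ε / 4 := by
      have h1 : K + 1 ≠ 0 := by positivity
      simp only [η]
      generalize youngConst (α + 1 / 2) = c at hC
      field_simp
    rw [← this]; gcongr; linarith
  rw [dist_eq_norm, ← sub_sub_sub_cancel_right _ _ (∑ i ∈ Finset.range N, ∑ j ∈ Finset.range M,
      cellTerm f g (t i) (t (i + 1)) (s j) (s (j + 1)))]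
  refine (norm_sub_le _ _).trans_lt ?_
  linarith

/-- The Young estimate for the increments of the integral. -/
lemma ControlledBy.norm_integral_sub_le (hv : IsControl T v) (hα : 1 / 2 < α)
    (hK : 0 ≤ K) (hκ : 0 ≤ κ) (hf : ControlledBy T v α K f) (hg : ControlledBy T v α κ g)
    {s t : ℝ} (hs : 0 ≤ s) (hst : s ≤ t) (ht : t ≤ T) {I J : A}
    (hI : HasYoungIntegral f g 0 s I) (hJ : HasYoungIntegral f g 0 t J) :
    ‖J - I - f s * (g t - g s)‖ ≤ youngConst (α + α) * (K * κ) * (v t - v s) ^ (α + α) := by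
  -- As both integrals exist, one convenient sequence of subdivisions computes each.
  have hI' := (hasYoungIntegral_iff.1 hI).comp (tendsto_uniformSubdivision hs)
  have hJ' := (hasYoungIntegral_iff.1 hJ).comp (tendsto_twoPartSubdivision hs hst)
  refine le_of_tendsto ((hJ'.sub hI').sub_const _).norm ?_
  filter_upwards [eventually_gt_atTop 0] with N hN
  have hN' : (0 : ℝ) < N := by exact_mod_cast hN
  set r : ℕ → ℝ := fun i => s + i * ((t - s) / N)
  have hts : 0 ≤ t - s := sub_nonneg.2 hst
  have hr : Monotone r := fun i j hij => by simp only [r]; gcongr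
  have hr0 : r 0 = s := by simp [r]
  have hrN : r N = t := by simp only [r]; field_simp; ring
  have key : riemannSum f g (twoPartSubdivision s t N) - riemannSum f g (uniformSubdivision s N) =
      ∑ i ∈ Finset.range N, f (r i) * (g (r (i + 1)) - g (r i)) := by
    rw [sub_eq_iff_eq_add', riemannSum, riemannSum]
    simp only [twoPartSubdivision, uniformSubdivision]
    rw [Finset.sum_range_add]
    congr 1
    · refine Finset.sum_congr rfl fun i hi => ?_
      have hi := Finset.mem_range.1 hi
      rw [min_eq_left hi.le, min_eq_left hi, Nat.sub_eq_zero_of_le hi.le, Nat.sub_eq_zero_of_le hi]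
      simp
    · refine Finset.sum_congr rfl fun i _ => ?_
      rw [min_eq_right (by omega), min_eq_right (by omega), add_assoc, Nat.add_sub_cancel_left,
        Nat.add_sub_cancel_left]
      have : (N : ℝ) * (s / N) = s := by field_simp
      simp only [r, this]
  have h1 := norm_riemannSum_sub_le (f := f) (g := g) hv (η := K * κ) (θ := α + α) (by linarith)
    (by positivity) (N := N) (t := r) (fun i j hij _ => hr hij) (by rw [hr0]; exact hs)
    (by rw [hrN]; exact ht) (by
      rw [hr0, hrN]
      intro x y z hx hxy hyz hz
      have w1 := hv.sub_nonneg (hs.trans hx) hxy (hyz.trans (hz.trans ht))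
      have w2 := hv.sub_nonneg (hs.trans (hx.trans hxy)) hyz (hz.trans ht)
      calc _ ≤ _ := norm_mul_le _ _
        _ ≤ (K * (v y - v x) ^ α) * (κ * (v z - v y) ^ α) := by
          gcongr
          · exact hf x y (hs.trans hx) hxy (hyz.trans (hz.trans ht))
          · exact hg y z (hs.trans (hx.trans hxy)) hyz (hz.trans ht)
        _ ≤ (K * (v z - v x) ^ α) * (κ * (v z - v x) ^ α) := by
          have w3 : 0 ≤ (v z - v x) ^ α := Real.rpow_nonneg (by linarith) _
          gcongr <;> linarith
        _ = _ := by rw [Real.rpow_add_of_nonneg (by linarith) (by linarith) (by linarith)]; ring)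
  rw [hr0, hrN] at h1
  simp only [Function.comp_apply, key]
  exact h1

/-- The indefinite Young integral is controlled by the same control. -/
theorem ControlledBy.integral (hv : IsControl T v) (hα : 1 / 2 < α)
    (hK : 0 ≤ K) (hκ : 0 ≤ κ) (hf : ControlledBy T v α K f) (hfb : ∀ t ∈ Icc 0 T, ‖f t‖ ≤ K)
    (hg : ControlledBy T v α κ g) {F : ℝ → A}
    (hF : ∀ t ∈ Icc 0 T, HasYoungIntegral f g 0 t (F t)) :
    ControlledBy T v α ((1 + youngConst (α + α)) * (K * κ)) F := by
  intro s t hs hst ht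
  have hC := youngConst_pos (θ := α + α) (by linarith)
  have h1 := hf.norm_integral_sub_le hv hα hK hκ hg hs hst ht (hF s ⟨hs, hst.trans ht⟩)
    (hF t ⟨hs.trans hst, ht⟩)
  have hω := hv.sub_nonneg hs hst ht
  have h2 := hv.rpow_le_one (β := α) (by linarith) hs hst ht
  have h3 := hg s t hs hst ht
  have h4 := hfb s ⟨hs, hst.trans ht⟩
  -- The remainder has exponent `α + α`; one factor `W` is bounded by `1`.
  rw [Real.rpow_add_of_nonneg hω (by linarith) (by linarith)] at h1
  set W := (v t - v s) ^ α
  have hW : 0 ≤ W := Real.rpow_nonneg hω _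
  calc ‖F t - F s‖ = ‖(F t - F s - f s * (g t - g s)) + f s * (g t - g s)‖ := by
        rw [sub_add_cancel]
    _ ≤ youngConst (α + α) * (K * κ) * (W * 1) + K * (κ * W) := by
        refine (norm_add_le _ _).trans (add_le_add (h1.trans (by gcongr)) ?_)
        exact (norm_mul_le _ _).trans (by gcongr)
    _ = _ := by ring

end Control

end PathDev

namespace PathDev

/-! ### From bounded variation to a control. -/

section Variation

variable {E : Type*} [NormedAddCommGroup E] {p T : ℝ} {γ : ℝ → E}

/-- The `p`-variation sums of `γ` on `[0, t]`. -/
def variationSums (p : ℝ) (γ : ℝ → E) (t : ℝ) : Set ℝ :=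
  {S | ∃ (N : ℕ) (τ : ℕ → ℝ), Monotone τ ∧ (∀ i, τ i ∈ Icc 0 t) ∧
    ∑ i ∈ Finset.range N, ‖γ (τ (i + 1)) - γ (τ i)‖ ^ p = S}

lemma zero_mem_variationSums {t : ℝ} (ht : 0 ≤ t) : 0 ∈ variationSums p γ t :=
  ⟨0, fun _ => 0, monotone_const, fun _ => ⟨le_rfl, ht⟩, by simp⟩

/-- Superadditivity of the variation: append `s` and then `t` to the subdivision. The extra jump
from its last point to `s` only increases the sum. -/
lemma add_mem_variationSums {s t S : ℝ} (hs : 0 ≤ s) (hst : s ≤ t) (hS : S ∈ variationSums p γ s) :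
    ∃ S' ∈ variationSums p γ t, S + ‖γ t - γ s‖ ^ p ≤ S' := by
  obtain ⟨N, τ, hτ, hmem, rfl⟩ := hS
  set σ : ℕ → ℝ := fun i => if i ≤ N then τ i else if i = N + 1 then s else t
  refine ⟨_, ⟨N + 2, σ, ?_, ?_, rfl⟩, ?_⟩
  · refine monotone_nat_of_le_succ fun i => ?_
    simp only [σ]
    rcases lt_trichotomy i N with h | h | h
    · rw [if_pos h.le, if_pos (by omega : i + 1 ≤ N)]; exact hτ (Nat.le_succ i)
    · subst h
      simp only [le_refl, if_true, Nat.not_succ_le_self, if_false]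
      exact (hmem i).2
    · rw [if_neg (by omega), if_neg (by omega : ¬ i + 1 ≤ N), if_neg (by omega : ¬ i + 1 = N + 1)]
      split_ifs
      exacts [hst, le_rfl]
  · intro i
    simp only [σ]
    split_ifs
    · exact ⟨(hmem i).1, (hmem i).2.trans hst⟩
    · exact ⟨hs, hst⟩
    · exact ⟨hs.trans hst, le_rfl⟩
  · rw [Finset.sum_range_succ, Finset.sum_range_succ]
    have e1 : σ (N + 1) = s := by simp [σ]
    have e2 : σ (N + 1 + 1) = t := by simp [σ]
    have e3 : ∑ i ∈ Finset.range N, ‖γ (σ (i + 1)) - γ (σ i)‖ ^ p =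
        ∑ i ∈ Finset.range N, ‖γ (τ (i + 1)) - γ (τ i)‖ ^ p := by
      refine Finset.sum_congr rfl fun i hi => ?_
      have hi := Finset.mem_range.1 hi
      simp only [σ]
      rw [if_pos hi.le, if_pos (by omega)]
    rw [e3, e1, e2]
    have : 0 ≤ ‖γ s - γ (σ N)‖ ^ p := Real.rpow_nonneg (norm_nonneg _) _
    linarith

/-- A path of bounded `p`-variation is Hölder continuous with exponent `1 / p` relative to a
control. -/
lemma BoundedPVariation.exists_control (hp : 1 ≤ p) (h : BoundedPVariation p γ 0 T) :
    ∃ v K, 0 ≤ K ∧ IsControl T v ∧ ControlledBy T v (1 / p) K γ := by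
  obtain ⟨C, hC⟩ := h
  -- The maximum with `1` keeps `c` positive; dividing the variation by `c` makes the total
  -- increment at most `1`.
  set c := max C 1
  have hc : 0 < c := lt_max_of_lt_right one_pos
  set V : ℝ → ℝ := fun t => sSup (variationSums p γ t)
  have hbd : ∀ t ≤ T, ∀ S ∈ variationSums p γ t, S ≤ c := by
    rintro t ht _ ⟨N, τ, hτ, hmem, rfl⟩
    exact (hC N τ hτ fun i => ⟨(hmem i).1, (hmem i).2.trans ht⟩).trans (le_max_left _ _)
  have hV : ∀ s t, 0 ≤ s → s ≤ t → t ≤ T → ‖γ t - γ s‖ ^ p ≤ V t - V s := by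
    intro s t hs hst ht
    have : V s ≤ V t - ‖γ t - γ s‖ ^ p := by
      refine csSup_le ⟨0, zero_mem_variationSums hs⟩ fun S hS => ?_
      obtain ⟨S', hS', hle⟩ := add_mem_variationSums hs hst hS
      have := le_csSup ⟨c, hbd t ht⟩ hS'
      linarith
    linarith
  have hV0 : ∀ t ∈ Icc 0 T, 0 ≤ V t := fun t ht =>
    le_csSup ⟨c, hbd t ht.2⟩ (zero_mem_variationSums ht.1)
  have hV1 : ∀ t ∈ Icc 0 T, V t ≤ c := fun t ht =>
    csSup_le ⟨0, zero_mem_variationSums ht.1⟩ (hbd t ht.2)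
  refine ⟨fun t => V t / c, c ^ (1 / p), by positivity, ⟨?_, ?_⟩, ?_⟩
  · intro s hs t ht hst
    have := hV s t hs.1 hst ht.2
    have h0 : 0 ≤ ‖γ t - γ s‖ ^ p := Real.rpow_nonneg (norm_nonneg _) _
    exact div_le_div_of_nonneg_right (by linarith) hc.le
  · intro s hs t ht
    rw [← sub_div, div_le_one hc]
    linarith [hV0 s hs, hV1 t ht]
  · intro s t hs hst ht
    have h1 := hV s t hs hst ht
    have h0 : 0 ≤ ‖γ t - γ s‖ ^ p := Real.rpow_nonneg (norm_nonneg _) _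
    rw [← sub_div, ← Real.mul_rpow hc.le (div_nonneg (h0.trans h1) hc.le),
      mul_div_cancel₀ _ hc.ne']
    calc ‖γ t - γ s‖ = (‖γ t - γ s‖ ^ p) ^ (1 / p) := by
          rw [← Real.rpow_mul (norm_nonneg _), mul_one_div_cancel (by linarith), Real.rpow_one]
      _ ≤ _ := by gcongr

end Variation

/-! ### Iterated integrals and geometric bounds. -/

section Iterated

variable {T α κ : ℝ} {v : ℝ → ℝ}

/-- As the control grows by at most `1`, the Hölder constant also bounds the size, so one constant
serves both halves of the inductions on the level. -/
lemma ControlledBy.norm_le {E : Type*} [NormedAddCommGroup E] {K : ℝ} {F : ℝ → E}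
    (hF : ControlledBy T v α K F) (hv : IsControl T v) (hα : 0 ≤ α) (hK : 0 ≤ K) (h0 : F 0 = 0)
    {t : ℝ} (ht : t ∈ Icc 0 T) : ‖F t‖ ≤ K := by
  have := hF 0 t le_rfl ht.1 ht.2
  rw [h0, sub_zero] at this
  exact this.trans (mul_le_of_le_one_right hK (hv.rpow_le_one hα le_rfl ht.1 ht.2))

lemma controlledBy_const {E : Type*} [NormedAddCommGroup E] {K : ℝ} (hv : IsControl T v)
    (hK : 0 ≤ K) (e : E) : ControlledBy T v α K fun _ => e := by
  intro s t hs hst ht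
  rw [sub_self, norm_zero]
  exact mul_nonneg hK (Real.rpow_nonneg (hv.sub_nonneg hs hst ht) _)

/-- Young's theorem for iterated integrals. -/
lemma youngIntegrable_iteratedIntegral {A : Type*} [NormedRing A] [NormOneClass A]
    [CompleteSpace A] (hv : IsControl T v) (hα : 1 / 2 < α) (hκ : 0 ≤ κ) {x : ℕ → ℝ → A}
    (hx : ∀ i, ControlledBy T v α κ (x i)) (hxc : ∀ i, ContinuousOn (x i) (Icc 0 T)) (m : ℕ) :
    ∀ t ∈ Icc 0 T, YoungIntegrable (iteratedIntegral m fun i : Fin m => x i) (x m) 0 t := by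
  have hC := youngConst_pos (θ := α + α) (by linarith)
  suffices h : ∃ K, 0 ≤ K ∧ ControlledBy T v α K (iteratedIntegral m fun i : Fin m => x i) ∧
      ∀ t ∈ Icc 0 T, ‖iteratedIntegral m (fun i : Fin m => x i) t‖ ≤ K by
    obtain ⟨K, hK, h, -⟩ := h
    exact fun t ht => h.youngIntegrable hv hα hK hκ (hx m) (hxc m) ht.1 ht.2
  induction m with
  | zero =>
    exact ⟨1, zero_le_one, controlledBy_const hv zero_le_one _, fun t _ => norm_one.le⟩
  | succ m ih =>
    obtain ⟨K, hK, h, hb⟩ := ih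
    have h' : ControlledBy T v α ((1 + youngConst (α + α)) * (K * κ))
        (iteratedIntegral (m + 1) fun i : Fin (m + 1) => x i) :=
      h.integral hv hα hK hκ hb (hx m) fun t ht =>
        (h.youngIntegrable hv hα hK hκ (hx m) (hxc m) ht.1 ht.2).hasYoungIntegral
    refine ⟨_, by positivity, h', fun t ht => ?_⟩
    exact h'.norm_le hv (by linarith) (by positivity) youngIntegral_self ht

variable {k : ℕ} {𝕜 : Type*} [RCLike 𝕜] {G : ℝ → Matrix (Fin k) (Fin k) 𝕜}

lemma hasYoungIntegral_of_controlled_entries {K : ℝ} {F : ℝ → Matrix (Fin k) (Fin k) 𝕜}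
    (hv : IsControl T v) (hα : 1 / 2 < α) (hK : 0 ≤ K) (hκ : 0 ≤ κ)
    (hF : ∀ i j, ControlledBy T v α K fun s => F s i j)
    (hG : ∀ i j, ControlledBy T v α κ fun s => G s i j)
    (hGc : ∀ i j, ContinuousOn (fun s => G s i j) (Icc 0 T)) {t : ℝ} (ht : t ∈ Icc 0 T) :
    HasYoungIntegral F G 0 t (Matrix.of fun i l =>
      ∑ j, youngIntegral (fun s => F s i j) (fun s => G s j l) 0 t) :=
  hasYoungIntegral_matrix fun i j l =>
    ((hF i j).youngIntegrable hv hα hK hκ (hG j l) (hGc j l) ht.1 ht.2).hasYoungIntegral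

/-- The terms of the development grow at most geometrically. -/
lemma iteratedIntegral_matrix_bound (hv : IsControl T v) (hα : 1 / 2 < α) (hκ : 0 ≤ κ)
    (hG : ∀ i j, ControlledBy T v α κ fun s => G s i j)
    (hGc : ∀ i j, ContinuousOn (fun s => G s i j) (Icc 0 T)) (m : ℕ) :
    (∀ i j, ControlledBy T v α (((1 + youngConst (α + α)) * k * κ) ^ m)
      fun s => iteratedIntegral m (fun _ => G) s i j) ∧
    ∀ i j, ∀ t ∈ Icc 0 T, ‖iteratedIntegral m (fun _ => G) t i j‖ ≤
      ((1 + youngConst (α + α)) * k * κ) ^ m := by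
  have hC := youngConst_pos (θ := α + α) (by linarith)
  induction m with
  | zero =>
    refine ⟨fun i j => controlledBy_const hv (by simp) _, fun i j t _ => ?_⟩
    simp only [iteratedIntegral, Matrix.one_apply, pow_zero]
    split_ifs <;> simp
  | succ m ih =>
    obtain ⟨h, hb⟩ := ih
    set L := (1 + youngConst (α + α)) * k * κ
    have hL : 0 ≤ L := by positivity
    have hval : ∀ t ∈ Icc 0 T, ∀ i l, iteratedIntegral (m + 1) (fun _ => G) t i l =
        ∑ j, youngIntegral (fun s => iteratedIntegral m (fun _ => G) s i j)
          (fun s => G s j l) 0 t := by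
      intro t ht i l
      have h1 : iteratedIntegral (m + 1) (fun _ => G) t = _ :=
        (hasYoungIntegral_of_controlled_entries hv hα (pow_nonneg hL m) hκ h hG hGc
          ht).youngIntegral_eq ht.1
      rw [h1, Matrix.of_apply]
    have h' : ∀ i l, ControlledBy T v α (L ^ (m + 1))
        fun s => iteratedIntegral (m + 1) (fun _ => G) s i l := by
      intro i l s t hs hst ht
      simp only
      rw [hval s ⟨hs, hst.trans ht⟩, hval t ⟨hs.trans hst, ht⟩, ← Finset.sum_sub_distrib]
      refine (norm_sum_le_of_le _ fun j _ => (h i j).integral hv hα (pow_nonneg hL m) hκ (hb i j)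
        (hG j l) (fun r hr => ((h i j).youngIntegrable hv hα (pow_nonneg hL m) hκ (hG j l) (hGc j l)
          hr.1 hr.2).hasYoungIntegral) s t hs hst ht).trans_eq ?_
      -- The `k` summands of a matrix product account for the factor `k` in the ratio `L`.
      rw [Finset.sum_const, Finset.card_univ, Fintype.card_fin, nsmul_eq_mul, pow_succ]
      simp only [L]; ring
    refine ⟨h', fun i l t ht => (h' i l).norm_le hv (by linarith) (by positivity) ?_ ht⟩
    have h0 : iteratedIntegral (m + 1) (fun _ => G) 0 = 0 := youngIntegral_self
    simp only [h0, Matrix.zero_apply]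

end Iterated

/-! ### The first row of the development. -/

section Tridiagonal

/-- The antisymmetric tridiagonal matrix with superdiagonal `a`. -/
def tridiagMatrix (k : ℕ) (a : ℕ → ℝ) : Matrix (Fin k) (Fin k) ℝ :=
  Matrix.of fun i j => if (j : ℕ) = i + 1 then a i else if (i : ℕ) = j + 1 then -a j else 0

lemma tridiagMatrix_mem (k : ℕ) (a : ℕ → ℝ) : tridiagMatrix k a ∈ tridiag k := by
  refine ⟨?_, fun i j hij => ?_⟩
  · ext i j
    simp only [tridiagMatrix, Matrix.add_apply, Matrix.transpose_apply, Matrix.of_apply,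
      Matrix.zero_apply]
    split_ifs <;> first | omega | simp
  · simp only [tridiagMatrix, Matrix.of_apply]
    split_ifs with h1 h2
    · refine absurd ?_ hij
      rw [h1]; simp
    · refine absurd ?_ hij
      rw [h2]; simp
    · rfl

lemma tridiagMatrix_apply_eq_zero {k : ℕ} {a : ℕ → ℝ} {i j : Fin k} (h : (i : ℕ) + 1 < j) :
    tridiagMatrix k a i j = 0 := by
  simp only [tridiagMatrix, Matrix.of_apply]
  rw [if_neg (by omega), if_neg (by omega)]

lemma tridiagMatrix_apply_succ {k : ℕ} {a : ℕ → ℝ} {i j : Fin k} (h : (j : ℕ) = i + 1) :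
    tridiagMatrix k a i j = a i := by
  simp only [tridiagMatrix, Matrix.of_apply, if_pos h]

variable {𝕜 : Type*} [RCLike 𝕜] {k : ℕ}

/-- Along the first row, the `m`-th term of the development at an antisymmetric tridiagonal matrix
vanishes beyond the `m`-th superdiagonal, on which it is an iterated integral of the entries. -/
lemma iteratedIntegral_tridiag_apply {T lam : ℝ} {x : ℕ → ℝ → ℝ} {G : ℝ → Matrix (Fin k) (Fin k) 𝕜}
    (hG : ∀ s, G s = (tridiagMatrix k fun i => lam * x i s).map (algebraMap ℝ 𝕜))
    (hx : ∀ m, ∀ t ∈ Icc 0 T, YoungIntegrable (iteratedIntegral m fun i : Fin m => x i) (x m) 0 t)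
    (hD : ∀ m, ∀ t ∈ Icc 0 T, YoungIntegrable (iteratedIntegral m fun _ => G) G 0 t)
    {o : Fin k} (ho : (o : ℕ) = 0) (m : ℕ) {t : ℝ} (ht : t ∈ Icc 0 T) (l : Fin k) (hl : m ≤ l) :
    iteratedIntegral m (fun _ => G) t o l = if (l : ℕ) = m then
      algebraMap ℝ 𝕜 (lam ^ m * iteratedIntegral m (fun i : Fin m => x i) t) else 0 := by
  induction m generalizing t l with
  | zero =>
    simp only [iteratedIntegral, Matrix.one_apply, Fin.ext_iff, ho, eq_comm (a := 0)]
    simp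
  | succ m ih =>
    set c : ℝ → ℝ := iteratedIntegral m fun i : Fin m => x i
    have hne := subdivisions_neBot ht.1
    have h1 := hasYoungIntegral_iff.1 (hD m t ht).hasYoungIntegral
    have h2 : Tendsto (fun P => riemannSum (iteratedIntegral m fun _ => G) G P o l)
        (subdivisions 0 t) (𝓝 (iteratedIntegral (m + 1) (fun _ => G) t o l)) :=
      tendsto_pi_nhds.1 (tendsto_pi_nhds.1 h1 o) l
    have hsum : ∀ᶠ P in subdivisions 0 t, riemannSum (iteratedIntegral m fun _ => G) G P o l =
        if (l : ℕ) = m + 1 then algebraMap ℝ 𝕜 (lam ^ (m + 1) * riemannSum c (x m) P) else 0 := by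
      filter_upwards [eventually_mem_subdivisions 0 t] with P hP
      have hterm : ∀ i ∈ Finset.range P.1, ((iteratedIntegral m (fun _ => G) (P.2 i)) *
          (G (P.2 (i + 1)) - G (P.2 i))) o l = if (l : ℕ) = m + 1 then
            algebraMap ℝ 𝕜 (lam ^ (m + 1) * (c (P.2 i) * (x m (P.2 (i + 1)) - x m (P.2 i)))) else 0 := by
        intro i hi
        have hmem := hP.2.2.2 i (Finset.mem_range.1 hi).le
        have hmem' : P.2 i ∈ Icc 0 T := ⟨hmem.1, hmem.2.trans ht.2⟩
        have hmk : m < k := by have := l.2; omega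
        -- Only `j = m` survives: for `j < m` the entry `(j, l)` lies above the superdiagonal
        -- because `l ≥ m + 1`, and for `j > m` the first factor vanishes by induction.
        rw [Matrix.mul_apply, Finset.sum_eq_single (⟨m, hmk⟩ : Fin k)]
        · rw [ih hmem' _ le_rfl, if_pos rfl]
          simp only [hG, Matrix.sub_apply, Matrix.map_apply]
          split_ifs with h
          · rw [tridiagMatrix_apply_succ h, tridiagMatrix_apply_succ h, ← map_sub, ← map_mul]
            congr 1; ring
          · rw [tridiagMatrix_apply_eq_zero (by simp only; omega),
              tridiagMatrix_apply_eq_zero (by simp only; omega)]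
            simp
        · intro j _ hj
          have hj' : (j : ℕ) ≠ m := fun h => hj (Fin.ext h)
          rcases lt_or_gt_of_ne hj' with h | h
          · simp only [hG, Matrix.sub_apply, Matrix.map_apply]
            rw [tridiagMatrix_apply_eq_zero (by omega), tridiagMatrix_apply_eq_zero (by omega)]
            simp
          · rw [ih hmem' j h.le, if_neg hj', zero_mul]
        · simp
      rw [riemannSum, Matrix.sum_apply, Finset.sum_congr rfl hterm]
      split_ifs
      · rw [riemannSum, Finset.mul_sum, map_sum]
      · simp
    refine tendsto_nhds_unique (h2.congr' hsum) ?_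
    split_ifs
    · have h3 := hasYoungIntegral_iff.1 (hx m t ht).hasYoungIntegral
      have h4 : Continuous (algebraMap ℝ 𝕜) := continuous_algebraMap ℝ 𝕜
      exact (h4.tendsto _).comp (h3.const_mul _)
    · exact tendsto_const_nhds

end Tridiagonal

/-! ### Developments along a word. -/

section Separation

variable {d k n : ℕ} {𝕜 : Type*} [RCLike 𝕜]

/-- The coordinates prescribed by a word, extended by `0`. -/
def wordCoord (W : Fin n → Fin d) (i : ℕ) (u : EuclideanSpace ℝ (Fin d)) : ℝ :=
  if h : i < n then u (W ⟨i, h⟩) else 0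

lemma norm_wordCoord_sub_le (W : Fin n → Fin d) (i : ℕ) (u w : EuclideanSpace ℝ (Fin d)) :
    ‖wordCoord W i u - wordCoord W i w‖ ≤ ‖u - w‖ := by
  rw [wordCoord, wordCoord]
  split_ifs
  · rw [← PiLp.sub_apply]; exact PiLp.norm_apply_le _ _
  · simp

lemma continuous_wordCoord (W : Fin n → Fin d) (i : ℕ) : Continuous (wordCoord W i) := by
  refine (LipschitzWith.of_dist_le_mul (K := 1) fun u w => ?_).continuous
  rw [dist_eq_norm, dist_eq_norm, NNReal.coe_one, one_mul]
  exact norm_wordCoord_sub_le W i u w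

/-- The linear map into the antisymmetric tridiagonal matrices whose superdiagonal reads off the
letters of a word, scaled by `lam`. -/
noncomputable def wordMap (𝔥 : LieSubalgebra ℝ (Matrix (Fin k) (Fin k) 𝕜))
    (h𝔥 : ∀ B ∈ tridiag k, B.map (algebraMap ℝ 𝕜) ∈ 𝔥) (W : Fin n → Fin d) (lam : ℝ) :
    EuclideanSpace ℝ (Fin d) →ₗ[ℝ] 𝔥 where
  toFun u := ⟨(tridiagMatrix k fun i => lam * wordCoord W i u).map (algebraMap ℝ 𝕜),
    h𝔥 _ (tridiagMatrix_mem _ _)⟩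
  map_add' u w := by
    refine Subtype.ext (Matrix.ext fun i j => ?_)
    change algebraMap ℝ 𝕜 (tridiagMatrix k (fun i => lam * wordCoord W i (u + w)) i j) =
      algebraMap ℝ 𝕜 (tridiagMatrix k (fun i => lam * wordCoord W i u) i j) +
        algebraMap ℝ 𝕜 (tridiagMatrix k (fun i => lam * wordCoord W i w) i j)
    simp only [tridiagMatrix, wordCoord, Matrix.of_apply, PiLp.add_apply]
    rw [← map_add]
    congr 1
    split_ifs <;> ring
  map_smul' c u := by
    refine Subtype.ext (Matrix.ext fun i j => ?_)
    change algebraMap ℝ 𝕜 (tridiagMatrix k (fun i => lam * wordCoord W i (c • u)) i j) =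
      c • algebraMap ℝ 𝕜 (tridiagMatrix k (fun i => lam * wordCoord W i u) i j)
    simp only [tridiagMatrix, wordCoord, Matrix.of_apply, PiLp.smul_apply, smul_eq_mul]
    rw [Algebra.smul_def, ← map_mul]
    congr 1
    split_ifs <;> ring

variable {𝔥 : LieSubalgebra ℝ (Matrix (Fin k) (Fin k) 𝕜)}
  {h𝔥 : ∀ B ∈ tridiag k, B.map (algebraMap ℝ 𝕜) ∈ 𝔥}

/-- Existence, geometric decay and leading entries of the development at a word. -/
lemma exists_developmentTerm_bound {p T : ℝ} (hp1 : 1 ≤ p) (hp2 : p < 2) (hT : 0 ≤ T)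
    {γ : ℝ → EuclideanSpace ℝ (Fin d)} (hc : ContinuousOn γ (Icc 0 T))
    (hγ : BoundedPVariation p γ 0 T) (W : Fin n → Fin d) :
    ∃ L : ℝ, 0 ≤ L ∧ ∀ lam : ℝ, 0 < lam →
      (∀ m, ∀ t ∈ Icc 0 T, YoungIntegrable (developmentTerm γ (wordMap 𝔥 h𝔥 W lam) m)
        (fun s => (wordMap 𝔥 h𝔥 W lam (γ s) : Matrix (Fin k) (Fin k) 𝕜)) 0 t) ∧
      (∀ m i j, ‖developmentTerm γ (wordMap 𝔥 h𝔥 W lam) m T i j‖ ≤ (L * lam) ^ m) ∧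
      ∀ o l : Fin k, (o : ℕ) = 0 → (l : ℕ) = n → ∀ m ≤ n,
        developmentTerm γ (wordMap 𝔥 h𝔥 W lam) m T o l = if m = n then
          algebraMap ℝ 𝕜 (lam ^ n * iteratedIntegral n (fun i s => γ s (W i)) T) else 0 := by
  obtain ⟨v, K, hK, hv, hγK⟩ := hγ.exists_control hp1
  have hα : 1 / 2 < 1 / p := one_div_lt_one_div_of_lt (by linarith) hp2
  set α := 1 / p
  have hC := youngConst_pos (θ := α + α) (by linarith)
  -- Fixed before `lam`: scaling the map only replaces the Hölder constant `K` by `lam * K`.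
  refine ⟨(1 + youngConst (α + α)) * k * K, by positivity, fun lam hlam => ?_⟩
  have hx : ∀ i, ControlledBy T v α K fun s => wordCoord W i (γ s) :=
    fun i s t hs hst ht => (norm_wordCoord_sub_le W i _ _).trans (hγK s t hs hst ht)
  have hxc : ∀ i, ContinuousOn (fun s => wordCoord W i (γ s)) (Icc 0 T) :=
    fun i => (continuous_wordCoord W i).comp_continuousOn hc
  set G : ℝ → Matrix (Fin k) (Fin k) 𝕜 := fun s => wordMap 𝔥 h𝔥 W lam (γ s) with hGdef
  have hGeq : ∀ s, G s = (tridiagMatrix k fun i => lam * wordCoord W i (γ s)).map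
    (algebraMap ℝ 𝕜) := fun s => rfl
  have hG : ∀ i j, ControlledBy T v α (lam * K) fun s => G s i j := by
    intro i j s t hs hst ht
    simp only [hGeq, Matrix.map_apply, tridiagMatrix, Matrix.of_apply]
    rw [← map_sub, norm_algebraMap', mul_assoc]
    have hnn := mul_nonneg hK (Real.rpow_nonneg (hv.sub_nonneg hs hst ht) α)
    split_ifs
    · rw [← mul_sub, norm_mul, Real.norm_of_nonneg hlam.le]
      exact mul_le_mul_of_nonneg_left (hx _ s t hs hst ht) hlam.le
    · rw [neg_sub_neg, norm_sub_rev, ← mul_sub, norm_mul, Real.norm_of_nonneg hlam.le]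
      exact mul_le_mul_of_nonneg_left (hx _ s t hs hst ht) hlam.le
    · rw [sub_self, norm_zero]; positivity
  have hGc : ∀ i j, ContinuousOn (fun s => G s i j) (Icc 0 T) := by
    intro i j
    simp only [hGeq, Matrix.map_apply, tridiagMatrix, Matrix.of_apply]
    refine (continuous_algebraMap ℝ 𝕜).comp_continuousOn ?_
    split_ifs
    · exact continuousOn_const.mul (hxc _)
    · exact (continuousOn_const.mul (hxc _)).neg
    · exact continuousOn_const
  have hκ : 0 ≤ lam * K := by positivity
  have hbound := iteratedIntegral_matrix_bound hv hα hκ hG hGc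
  have hint : ∀ m, ∀ t ∈ Icc 0 T, YoungIntegrable (iteratedIntegral m fun _ => G) G 0 t :=
    fun m t ht => ⟨_, hasYoungIntegral_of_controlled_entries hv hα (by positivity) hκ (hbound m).1
      hG hGc ht⟩
  refine ⟨hint, fun m i j => ?_, fun o l ho hl m hm => ?_⟩
  · refine ((hbound m).2 i j T ⟨hT, le_rfl⟩).trans_eq ?_
    congr 1; ring
  · refine (iteratedIntegral_tridiag_apply hGeq (youngIntegrable_iteratedIntegral hv hα hK hx hxc)
      hint ho m ⟨hT, le_rfl⟩ l (by omega)).trans ?_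
    simp only [hl, eq_comm (a := n)]
    split_ifs with h
    · subst h
      simp [wordCoord]
    · rfl

lemma summable_matrix_of_norm_le {F : ℕ → Matrix (Fin k) (Fin k) 𝕜} {q : ℝ} (hq : 0 ≤ q)
    (hq1 : q < 1) (h : ∀ m i j, ‖F m i j‖ ≤ q ^ m) : Summable F :=
  Pi.summable.2 fun i => Pi.summable.2 fun j =>
    Summable.of_norm_bounded (summable_geometric_of_lt_one hq hq1) fun m => h m i j

lemma tsum_matrix_apply {F : ℕ → Matrix (Fin k) (Fin k) 𝕜} (hF : Summable F) (i j : Fin k) :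
    (∑' m, F m) i j = ∑' m, F m i j := by
  have h1 : (∑' m, F m) i = ∑' m, F m i := tsum_apply hF
  rw [h1]
  exact tsum_apply (Pi.summable.1 hF i)

/-- A series with leading term of index `n` and a geometrically small tail does not vanish. -/
lemma tsum_ne_zero_of_leading_term {a : ℕ → 𝕜} {q : ℝ} (hq : 0 ≤ q) (hq1 : q ≤ 1 / 2)
    (ha : ∀ m, ‖a m‖ ≤ 2 * q ^ m) (h0 : ∀ m < n, a m = 0) (hn : 4 * q ^ (n + 1) < ‖a n‖) :
    ∑' m, a m ≠ 0 := by
  have hq2 : q < 1 := by linarith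
  have hgeom := (summable_geometric_of_lt_one hq hq2).mul_left 2
  have hs : Summable a := Summable.of_norm_bounded hgeom ha
  have htail : ‖∑' m, a (m + (n + 1))‖ ≤ 4 * q ^ (n + 1) := by
    have h1 : HasSum (fun m => 2 * q ^ (n + 1) * q ^ m) (2 * q ^ (n + 1) * (1 - q)⁻¹) :=
      (hasSum_geometric_of_lt_one hq hq2).mul_left _
    refine (tsum_of_norm_bounded h1 fun m => (ha _).trans_eq (by ring_nf)).trans ?_
    have h2 : (1 - q)⁻¹ ≤ 2 := by
      rw [inv_le_comm₀ (by linarith) two_pos]; linarith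
    calc _ ≤ 2 * q ^ (n + 1) * 2 := by gcongr
      _ = _ := by ring
  rw [← hs.sum_add_tsum_nat_add (n + 1), Finset.sum_range_succ,
    Finset.sum_eq_zero fun m hm => h0 m (Finset.mem_range.1 hm), zero_add]
  intro h
  rw [add_eq_zero_iff_eq_neg] at h
  rw [h, norm_neg] at hn
  linarith

/-- Equal coefficients give equal tensors; this direction does not need the basis tensors to be
independent. -/
lemma exists_word_of_signature_ne {T₁ T₂ : ℝ} {γ₁ γ₂ : ℝ → EuclideanSpace ℝ (Fin d)}
    (h : signature T₁ γ₁ n ≠ signature T₂ γ₂ n) :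
    ∃ W : Fin n → Fin d, iteratedIntegral n (fun i s => γ₁ s (W i)) T₁ ≠
      iteratedIntegral n (fun i s => γ₂ s (W i)) T₂ := by
  by_contra! hW
  exact h (Finset.sum_congr rfl fun W _ => by rw [hW W])

end Separation

end PathDev

/-! ### Choice of the scale and conclusion. -/

theorem corollary5p1 {d : ℕ} {p : ℝ} (hp1 : 1 ≤ p) (hp2 : p < 2)
    {T₁ T₂ : ℝ} (hT₁ : 0 ≤ T₁) (hT₂ : 0 ≤ T₂)
    (γ₁ γ₂ : ℝ → EuclideanSpace ℝ (Fin d))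
    (hc₁ : ContinuousOn γ₁ (Icc 0 T₁)) (hc₂ : ContinuousOn γ₂ (Icc 0 T₂))
    (hv₁ : PathDev.BoundedPVariation p γ₁ 0 T₁) (hv₂ : PathDev.BoundedPVariation p γ₂ 0 T₂)
    (n : ℕ) (hn : PathDev.signature T₁ γ₁ n ≠ PathDev.signature T₂ γ₂ n)
    (k : ℕ) (hk : n + 1 ≤ k) {𝕜 : Type*} [RCLike 𝕜]
    (𝔥 : LieSubalgebra ℝ (Matrix (Fin k) (Fin k) 𝕜))
    (h𝔥 : ∀ B ∈ PathDev.tridiag k, B.map (algebraMap ℝ 𝕜) ∈ 𝔥) :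
    ∃ M : EuclideanSpace ℝ (Fin d) →ₗ[ℝ] 𝔥,
      (∀ v, ∃ B ∈ PathDev.tridiag k,
        (M v : Matrix (Fin k) (Fin k) 𝕜) = B.map (algebraMap ℝ 𝕜)) ∧
      PathDev.DevelopmentConverges T₁ γ₁ M ∧ PathDev.DevelopmentConverges T₂ γ₂ M ∧
      PathDev.development T₁ γ₁ M ≠ PathDev.development T₂ γ₂ M := by
  open PathDev in
  obtain ⟨W, hW⟩ := exists_word_of_signature_ne hn
  obtain ⟨L₁, hL₁, H₁⟩ := exists_developmentTerm_bound (h𝔥 := h𝔥) hp1 hp2 hT₁ hc₁ hv₁ W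
  obtain ⟨L₂, hL₂, H₂⟩ := exists_developmentTerm_bound (h𝔥 := h𝔥) hp1 hp2 hT₂ hc₂ hv₂ W
  set c := iteratedIntegral n (fun i s => γ₁ s (W i)) T₁ -
    iteratedIntegral n (fun i s => γ₂ s (W i)) T₂
  have hc : 0 < |c| := abs_pos.2 (sub_ne_zero.2 hW)
  -- One ratio dominating both paths; the `1` makes it positive.
  set L := L₁ + L₂ + 1
  have hL : 0 < L := by positivity
  obtain ⟨lam, hlam, hlam1, hlam2⟩ : ∃ lam : ℝ, 0 < lam ∧ L * lam ≤ 1 / 2 ∧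
      4 * L ^ (n + 1) * lam < |c| := by
    -- The first bound makes the ratio at most `1 / 2`; the second puts the tail below the leading
    -- term once `lam ^ n` is factored out.
    refine ⟨min (1 / (2 * L)) (|c| / (8 * L ^ (n + 1))), by positivity, ?_, ?_⟩
    · calc _ ≤ L * (1 / (2 * L)) := by gcongr; exact min_le_left _ _
        _ = 1 / 2 := by field_simp
    · calc _ ≤ 4 * L ^ (n + 1) * (|c| / (8 * L ^ (n + 1))) := by gcongr; exact min_le_right _ _
        _ = |c| / 2 := by field_simp; norm_num
        _ < |c| := by linarith
  obtain ⟨hI₁, hB₁, hE₁⟩ := H₁ lam hlam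
  obtain ⟨hI₂, hB₂, hE₂⟩ := H₂ lam hlam
  set M := wordMap 𝔥 h𝔥 W lam
  have hq : 0 ≤ L * lam := by positivity
  have hq1 : L * lam < 1 := by linarith
  have hB₁' : ∀ m i j, ‖developmentTerm γ₁ M m T₁ i j‖ ≤ (L * lam) ^ m := fun m i j =>
    (hB₁ m i j).trans (by gcongr; simp only [L]; linarith)
  have hB₂' : ∀ m i j, ‖developmentTerm γ₂ M m T₂ i j‖ ≤ (L * lam) ^ m := fun m i j =>
    (hB₂ m i j).trans (by gcongr; simp only [L]; linarith)
  have hS₁ := summable_matrix_of_norm_le hq hq1 hB₁'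
  have hS₂ := summable_matrix_of_norm_le hq hq1 hB₂'
  refine ⟨M, fun u => ⟨_, tridiagMatrix_mem _ _, rfl⟩, ⟨hI₁, hS₁⟩, ⟨hI₂, hS₂⟩, fun heq => ?_⟩
  -- The entry `(0, n)` exists because `n + 1 ≤ k`.
  set o : Fin k := ⟨0, by omega⟩
  set l : Fin k := ⟨n, by omega⟩
  have hdiff : ∑' m, (developmentTerm γ₁ M m T₁ o l - developmentTerm γ₂ M m T₂ o l) = 0 := by
    rw [Summable.tsum_sub (Pi.summable.1 (Pi.summable.1 hS₁ o) l)
      (Pi.summable.1 (Pi.summable.1 hS₂ o) l), ← tsum_matrix_apply hS₁, ← tsum_matrix_apply hS₂,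
      sub_eq_zero]
    exact congrFun (congrFun heq o) l
  refine tsum_ne_zero_of_leading_term (n := n) hq hlam1 (fun m => ?_) (fun m hm => ?_) ?_ hdiff
  · exact (norm_sub_le _ _).trans (by linarith [hB₁' m o l, hB₂' m o l])
  · rw [hE₁ o l rfl rfl m hm.le, hE₂ o l rfl rfl m hm.le, if_neg hm.ne, if_neg hm.ne, sub_self]
  · rw [hE₁ o l rfl rfl n le_rfl, hE₂ o l rfl rfl n le_rfl, if_pos rfl, if_pos rfl, ← map_sub,
      ← mul_sub, norm_algebraMap', norm_mul, norm_pow, Real.norm_of_nonneg hlam.le, Real.norm_eq_abs]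
    calc 4 * (L * lam) ^ (n + 1) = lam ^ n * (4 * L ^ (n + 1) * lam) := by ring_nf
      _ < _ := by gcongr
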